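/- Let $0<\alpha\le 1$ and let $E_\alpha(z)=\sum_{n\ge 0} z^n/\Gamma(\alpha n+1)$ be the Mittag-Leffler function. Let $X_1,X_2,\dots$ be i.i.d. real random variables with CDF $F_{X_1}(w)=\mathbb P(X_1\le w)$. Let $J_1,J_2,\dots$ be i.i.d. random variables with $\mathbb P(J_1>t)=E_\alpha(-t^\alpha)$ for all $t\ge 0$ (so $J_1>0$ almost surely). Put $T_n=J_1+\dots+J_n$, $T_0=0$, and $N_\alpha(t)=\max\{n\ge 0: T_n\le t\}$ for $t\ge0$. Assume that for each $t\ge 0$ the variable $N_\alpha(t)$ is independent of the sequence $(X_i)_{i\ge1}$. Let $S(t)=\max(X_1,\dots,X_{N_\alpha(t)})$, where the maximum of the empty family (the case $N_\alpha(t)=0$) is given a fixed value $e\in[-\infty,\infty)$. For example, one may take $e=-\infty$, or $e=0$ when the $X_i$ are positive. Then: 1. Almost surely, the maximum defining $N_\alpha(t)$ exists for all $t\ge 0$. For every real $w\ge e$ (hence every real $w$ if $e=-\infty$) and every $t\ge 0$, $$\mathbb P(S(t)\le w)=E_\alpha\bigl(-(1-F_{X_1}(w))\,t^\alpha\bigr).$$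 2. If $\alpha<1$, then for every real $w\ge e$ the function $Q(t)=\mathbb P(S(t)\le w)$ is the unique solution on $[0,\infty)$ of the Caputo fractional relaxation problem $$\frac{1}{\Gamma(1-\alpha)}\int_0^t (t-u)^{-\alpha}\,Q'(u)\,du=-(1-F_{X_1}(w))\,Q(t)\quad(t>0),\qquad Q(0)=1,$$ among functions that are continuous on $[0,\infty)$, differentiable on $(0,\infty)$, and for which the integral converges absolutely for every $t>0$. 3. If $\alpha=1$ and $X_1$ is exponentially distributed with rate $r>0$, then for every real $w\ge\max(e,0)$ and every $t\ge 0$ $$\mathbb P(S(t)\le w)=\exp\bigl(-e^{-rw}\,t\bigr).$$ For $t>0$ the right-hand side is the value at $w$ of the CDF $\exp\bigl(-e^{-(w-m)/b}\bigr)$ of the Gumbel law with location $m=(\log t)/r$ and scale $b=1/r$. For $r=1$ it is $\exp(-e^{-w}t)$. -/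

import Mathlib

open MeasureTheory ProbabilityTheory

noncomputable section

/-- The one-parameter Mittag-Leffler function `E_α(z) = ∑ z ^ n / Γ(α n + 1)` on the real line
(the series converges absolutely for every real `z` as soon as `0 < α`). -/
def mittagLeffler (α z : ℝ) : ℝ :=
  ∑' n : ℕ, z ^ n / Real.Gamma (α * n + 1)

/-- The epochs `T_n = J_1 + ⋯ + J_n`; the sequence is indexed from `0`, so that
`J i` is the interarrival time `J_{i+1}`. -/
def epoch {Ω : Type*} (J : ℕ → Ω → ℝ) (n : ℕ) (ω : Ω) : ℝ :=
  ∑ i ∈ Finset.range n, J i ω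

/-- The counting process `N(t) = max {n : T_n ≤ t}`. -/
def renewalCount {Ω : Type*} (J : ℕ → Ω → ℝ) (t : ℝ) (ω : Ω) : ℕ :=
  sSup {n : ℕ | epoch J n ω ≤ t}

/-- `max (x_1, …, x_n)` (the sequence being indexed from `0`), where the maximum of the empty
family is given the value `e`. -/
def maxStat (e : EReal) (x : ℕ → ℝ) (n : ℕ) : EReal :=
  if n = 0 then e else (Finset.range n).sup fun i => (x i : EReal)

/-- The continuous-time maximum `S(t) = max (X_1, …, X_{N(t)})`. -/
def ctMax {Ω : Type*} (e : EReal) (X J : ℕ → Ω → ℝ) (t : ℝ) (ω : Ω) : EReal :=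
  maxStat e (fun i => X i ω) (renewalCount J t ω)

/-- The value at `w` of the cumulative distribution function of the continuous-time maximum. -/
def ctMaxCDF {Ω : Type*} [MeasurableSpace Ω] (μ : Measure Ω) (e : EReal) (X J : ℕ → Ω → ℝ)
    (w t : ℝ) : ℝ :=
  μ.real {ω | ctMax e X J t ω ≤ (w : EReal)}

/-- The Caputo derivative of order `α`, `0 < α < 1`, based at time `0`. -/
def caputoDeriv (α : ℝ) (f : ℝ → ℝ) (t : ℝ) : ℝ :=
  1 / Real.Gamma (1 - α) * ∫ u in (0 : ℝ)..t, (t - u) ^ (-α) * deriv f u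

/-- `f` solves on `[0, ∞)` the Cauchy problem `∂^α f / ∂t^α = - c f`, `f 0 = 1`: `f` is continuous
on `[0, ∞)` and differentiable on `(0, ∞)`, the integral in the Caputo derivative converges
absolutely at every `t > 0`, and the equation holds there. -/
structure IsFracRelaxation (α c : ℝ) (f : ℝ → ℝ) : Prop where
  continuousOn : ContinuousOn f (Set.Ici 0)
  differentiableAt : ∀ t : ℝ, 0 < t → DifferentiableAt ℝ f t
  initial : f 0 = 1
  integrable : ∀ t : ℝ, 0 < t →
    IntervalIntegrable (fun u => (t - u) ^ (-α) * deriv f u) volume 0 t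
  equation : ∀ t : ℝ, 0 < t → caputoDeriv α f t = -c * f t

/-- The cumulative distribution function of the Gumbel law with location `m` and scale `b`. -/
def gumbelCDF (m b w : ℝ) : ℝ :=
  Real.exp (-Real.exp (-(w - m) / b))

end

open MeasureTheory ProbabilityTheory

noncomputable section

/-- A scaled form of the Beta integral. -/
theorem integral_sub_rpow_mul_rpow {x y t : ℝ} (hx : 0 < x) (hy : 0 < y) (ht : 0 < t) :
    ∫ u in (0 : ℝ)..t, (t - u) ^ (x - 1) * u ^ (y - 1) =
      Real.Gamma x * Real.Gamma y / Real.Gamma (x + y) * t ^ (x + y - 1) := by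
  have h := Complex.betaIntegral_scaled (y : ℂ) (x : ℂ) ht
  rw [Complex.betaIntegral_eq_Gamma_mul_div _ _ (by simpa) (by simpa)] at h
  have h1 : ∫ u in (0 : ℝ)..t, (u : ℂ) ^ ((y : ℂ) - 1) * ((t : ℂ) - u) ^ ((x : ℂ) - 1)
      = ∫ u in (0 : ℝ)..t, (((t - u) ^ (x - 1) * u ^ (y - 1) : ℝ) : ℂ) := by
    refine intervalIntegral.integral_congr fun u hu => ?_
    rw [Set.uIcc_of_le ht.le] at hu
    have h2 : 0 ≤ t - u := by linarith [hu.2]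
    simp only [Complex.ofReal_mul, Complex.ofReal_cpow hu.1, Complex.ofReal_cpow h2]
    push_cast
    ring
  rw [h1, intervalIntegral.integral_ofReal] at h
  have h2 : ((t : ℂ) ^ ((y : ℂ) + x - 1) * (Complex.Gamma y * Complex.Gamma x /
      Complex.Gamma (y + x))) = ((Real.Gamma x * Real.Gamma y / Real.Gamma (x + y)
        * t ^ (x + y - 1) : ℝ) : ℂ) := by
    rw [← Complex.ofReal_add, Complex.Gamma_ofReal, Complex.Gamma_ofReal, Complex.Gamma_ofReal]
    push_cast [Complex.ofReal_cpow ht.le]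
    rw [add_comm (y : ℂ) x, add_comm y x]
    ring
  rw [h2] at h
  exact_mod_cast h

theorem intervalIntegrable_sub_rpow_mul_rpow {x y t : ℝ} (hx : 0 < x) (hy : 0 < y) (ht : 0 < t) :
    IntervalIntegrable (fun u => (t - u) ^ (x - 1) * u ^ (y - 1)) volume 0 t := by
  by_contra h
  have h1 := intervalIntegral.integral_undef h
  rw [integral_sub_rpow_mul_rpow hx hy ht] at h1
  have := Real.Gamma_pos_of_pos hx
  have := Real.Gamma_pos_of_pos hy
  have := Real.Gamma_pos_of_pos (add_pos hx hy)
  exact absurd h1 (by positivity)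

/-- Superexponential growth of the Gamma function. -/
theorem rpow_mul_exp_le_Gamma {R x : ℝ} (hR : 0 < R) (hx : 1 ≤ x) :
    R ^ (x - 1) * Real.exp (-(R + 1)) ≤ Real.Gamma x := by
  rw [Real.Gamma_eq_integral (by linarith)]
  have h0 := Real.GammaIntegral_convergent (s := x) (by linarith)
  have hsub : Set.Ioc R (R + 1) ⊆ Set.Ioi 0 := fun u hu => lt_trans hR hu.1
  calc R ^ (x - 1) * Real.exp (-(R + 1))
      = ∫ _u in Set.Ioc R (R + 1), R ^ (x - 1) * Real.exp (-(R + 1)) := by simp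
    _ ≤ ∫ u in Set.Ioc R (R + 1), Real.exp (-u) * u ^ (x - 1) := by
        refine setIntegral_mono_on (integrableOn_const (by simp)) (h0.mono_set hsub) measurableSet_Ioc fun u hu => ?_
        rw [mul_comm]
        exact mul_le_mul (Real.exp_le_exp.2 (by linarith [hu.2]))
          (Real.rpow_le_rpow hR.le hu.1.le (by linarith)) (by positivity) (by positivity)
    _ ≤ _ := setIntegral_mono_set h0 ((ae_restrict_mem measurableSet_Ioi).mono fun u hu => by
        have : 0 < u := hu
        positivity) hsub.eventuallyLE

theorem summable_pow_div_Gamma {α x : ℝ} (hα : 0 < α) (z : ℝ) :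
    Summable fun n : ℕ => z ^ n / Real.Gamma (α * n + x) := by
  set R : ℝ := (2 * (|z| + 1)) ^ (1 / α) with hRdef
  have hb : 0 < 2 * (|z| + 1) := by positivity
  have hR : 0 < R := Real.rpow_pos_of_pos hb _
  have hRα : R ^ α = 2 * (|z| + 1) := by
    rw [hRdef, ← Real.rpow_mul hb.le, one_div_mul_cancel hα.ne', Real.rpow_one]
  have hev : ∀ᶠ n : ℕ in Filter.atTop, 1 ≤ α * n + x := by
    have : Filter.Tendsto (fun n : ℕ => α * (n : ℝ) + x) Filter.atTop Filter.atTop :=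
      Filter.tendsto_atTop_add_const_right _ _
        ((tendsto_natCast_atTop_atTop (R := ℝ)).const_mul_atTop hα)
    exact this.eventually_ge_atTop 1
  refine Summable.of_norm_bounded_eventually_nat
    (g := fun n : ℕ => Real.exp (R + 1) * R ^ (1 - x) * (1 / 2) ^ n)
    ((summable_geometric_of_lt_one (by norm_num) (by norm_num)).mul_left _) ?_
  filter_upwards [hev] with n hn
  have hG := rpow_mul_exp_le_Gamma hR hn
  have hGp : 0 < Real.Gamma (α * n + x) := Real.Gamma_pos_of_pos (by linarith)
  rw [norm_div, norm_pow, Real.norm_eq_abs, Real.norm_eq_abs, abs_of_pos hGp, div_le_iff₀ hGp]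
  calc |z| ^ n ≤ (|z| + 1) ^ n := by gcongr; linarith
    _ = Real.exp (R + 1) * R ^ (1 - x) * (1 / 2) ^ n *
        (R ^ (α * n + x - 1) * Real.exp (-(R + 1))) := by
        have e1 : R ^ (α * n + x - 1) = (2 * (|z| + 1)) ^ n * R ^ (x - 1) := by
          rw [← hRα, ← Real.rpow_natCast (R ^ α) n, ← Real.rpow_mul hR.le, ← Real.rpow_add hR]
          ring_nf
        have e2 : R ^ (1 - x) * R ^ (x - 1) = 1 := by
          rw [← Real.rpow_add hR]; simp
        have e3 : Real.exp (R + 1) * Real.exp (-(R + 1)) = 1 := by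
          rw [← Real.exp_add]; simp
        have e4 : (1 / 2 : ℝ) ^ n * (2 * (|z| + 1)) ^ n = (|z| + 1) ^ n := by
          rw [← mul_pow]; congr 1; ring
        rw [e1]
        linear_combination (-(Real.exp (R + 1) * Real.exp (-(R + 1)) * (R ^ (1 - x) * R ^ (x - 1)))) * e4
          - (|z|+1)^n * (R ^ (1 - x) * R ^ (x - 1)) * e3 - (|z|+1)^n * e2
    _ ≤ _ := by gcongr

/-- The power series `∑ a_n z ^ n / Γ(α n + x)`. -/
def mlSeries (α x : ℝ) (a : ℕ → ℝ) (z : ℝ) : ℝ :=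
  ∑' n : ℕ, a n * z ^ n / Real.Gamma (α * n + x)

variable {α x y : ℝ} {a b : ℕ → ℝ}

theorem norm_mul_pow_div_Gamma_le (hα : 0 < α) (hx : 0 < x) (ha : ∀ n, |a n| ≤ 1) {z r : ℝ}
    (hz : |z| ≤ r) (n : ℕ) :
    ‖a n * z ^ n / Real.Gamma (α * n + x)‖ ≤ r ^ n / Real.Gamma (α * n + x) := by
  have hG : 0 < Real.Gamma (α * n + x) := Real.Gamma_pos_of_pos (by positivity)
  rw [norm_div, norm_mul, norm_pow, Real.norm_eq_abs, Real.norm_eq_abs, Real.norm_eq_abs,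
    abs_of_pos hG]
  gcongr
  calc |a n| * |z| ^ n ≤ 1 * r ^ n := by
        gcongr
        exact ha n
    _ = r ^ n := one_mul _

theorem summable_mlSeries (hα : 0 < α) (hx : 0 < x) (ha : ∀ n, |a n| ≤ 1) (z : ℝ) :
    Summable fun n : ℕ => a n * z ^ n / Real.Gamma (α * n + x) :=
  (summable_pow_div_Gamma hα |z|).of_norm_bounded
    fun n => norm_mul_pow_div_Gamma_le hα hx ha le_rfl n

theorem continuous_mlSeries (hα : 0 < α) (hx : 0 < x) (ha : ∀ n, |a n| ≤ 1) :
    Continuous (mlSeries α x a) := by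
  rw [continuous_iff_continuousAt]
  intro z
  have h : ContinuousOn (mlSeries α x a) (Set.Ioo (-(|z| + 1)) (|z| + 1)) :=
    continuousOn_tsum (fun n => by fun_prop) (summable_pow_div_Gamma hα (x := x) (|z| + 1))
      fun n w hw => norm_mul_pow_div_Gamma_le hα hx ha (abs_le.2 ⟨hw.1.le, hw.2.le⟩) n
  refine h.continuousAt (Ioo_mem_nhds ?_ ?_)
  · linarith [neg_abs_le z]
  · linarith [le_abs_self z]

theorem abs_mlSeries_le (hα : 0 < α) (hx : 0 < x) (ha : ∀ n, |a n| ≤ 1) {z r : ℝ}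
    (hz : |z| ≤ r) : |mlSeries α x a z| ≤ ∑' n : ℕ, r ^ n / Real.Gamma (α * n + x) :=
  tsum_of_norm_bounded (summable_pow_div_Gamma hα r).hasSum
    fun n => norm_mul_pow_div_Gamma_le hα hx ha hz n

/-- The function `∑ a_n t ^ (α n + x - 1) / Γ(α n + x)` of `t > 0`. -/
def mlFun (α x : ℝ) (a : ℕ → ℝ) (t : ℝ) : ℝ :=
  t ^ (x - 1) * mlSeries α x a (t ^ α)

theorem rpow_mul_mlSeries_term (x : ℝ) (a : ℕ → ℝ) {t : ℝ} (ht : 0 < t) (n : ℕ) :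
    t ^ (x - 1) * (a n * (t ^ α) ^ n / Real.Gamma (α * n + x)) =
      a n * (t ^ (α * n + x - 1) / Real.Gamma (α * n + x)) := by
  rw [show α * n + x - 1 = (x - 1) + α * n by ring, Real.rpow_add ht, Real.rpow_mul ht.le,
    Real.rpow_natCast]
  ring

theorem hasSum_mlFun (hα : 0 < α) (hx : 0 < x) (ha : ∀ n, |a n| ≤ 1) {t : ℝ} (ht : 0 < t) :
    HasSum (fun n : ℕ => a n * (t ^ (α * n + x - 1) / Real.Gamma (α * n + x)))
      (mlFun α x a t) := by
  simpa only [rpow_mul_mlSeries_term x a ht] using!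
    (summable_mlSeries hα hx ha (t ^ α)).hasSum.mul_left (t ^ (x - 1))

theorem continuousOn_mlFun (hα : 0 < α) (hx : 0 < x) (ha : ∀ n, |a n| ≤ 1) :
    ContinuousOn (mlFun α x a) (Set.Ioi 0) := by
  refine ContinuousOn.mul (fun t ht => ?_) ?_
  · exact (Real.continuousAt_rpow_const _ _ (Or.inl (ne_of_gt ht))).continuousWithinAt
  · exact ((continuous_mlSeries hα hx ha).comp (Real.continuous_rpow_const hα.le)).continuousOn

theorem intervalIntegrable_mlFun_mul (hα : 0 < α) (hx : 0 < x) (hy : 0 < y)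
    (ha : ∀ n, |a n| ≤ 1) (hb : ∀ n, |b n| ≤ 1) {t : ℝ} (ht : 0 < t) :
    IntervalIntegrable (fun u => mlFun α x a (t - u) * mlFun α y b u) volume 0 t := by
  set A := ∑' n : ℕ, (t ^ α) ^ n / Real.Gamma (α * n + x)
  set B := ∑' n : ℕ, (t ^ α) ^ n / Real.Gamma (α * n + y)
  have h0 := (intervalIntegrable_sub_rpow_mul_rpow hx hy ht).const_mul (A * B)
  rw [intervalIntegrable_iff_integrableOn_Ioo_of_le ht.le] at h0 ⊢
  refine h0.mono' ?_ ?_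
  · refine ContinuousOn.aestronglyMeasurable ?_ measurableSet_Ioo
    refine ContinuousOn.mul ?_ ((continuousOn_mlFun hα hy hb).mono fun u hu => hu.1)
    exact (continuousOn_mlFun hα hx ha).comp (by fun_prop) fun u hu => sub_pos.2 hu.2
  · refine ae_restrict_of_forall_mem measurableSet_Ioo fun u hu => ?_
    have hu0 : 0 < u := hu.1
    have hu1 : 0 < t - u := sub_pos.2 hu.2
    have k1 : |mlSeries α x a ((t - u) ^ α)| ≤ A := by
      refine abs_mlSeries_le hα hx ha ?_
      rw [abs_of_nonneg (by positivity)]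
      gcongr
      linarith
    have k2 : |mlSeries α y b (u ^ α)| ≤ B := by
      refine abs_mlSeries_le hα hy hb ?_
      rw [abs_of_nonneg (by positivity)]
      gcongr
      exact hu.2.le
    have hA : 0 ≤ A := (abs_nonneg _).trans k1
    rw [mlFun, mlFun, Real.norm_eq_abs, abs_mul, abs_mul, abs_mul,
      abs_of_pos (Real.rpow_pos_of_pos hu0 _), abs_of_pos (Real.rpow_pos_of_pos hu1 _)]
    calc (t - u) ^ (x - 1) * |mlSeries α x a ((t - u) ^ α)| *
          (u ^ (y - 1) * |mlSeries α y b (u ^ α)|)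
        ≤ (t - u) ^ (x - 1) * A * (u ^ (y - 1) * B) := by gcongr
      _ = _ := by ring

/-- Fractional powers normalized by the Gamma function form a convolution semigroup. -/
theorem integral_rpow_div_Gamma_mul {p q t : ℝ} (hp : 0 < p) (hq : 0 < q) (ht : 0 < t) :
    ∫ u in (0 : ℝ)..t, (t - u) ^ (p - 1) / Real.Gamma p * (u ^ (q - 1) / Real.Gamma q) =
      t ^ (p + q - 1) / Real.Gamma (p + q) := by
  have h : ∀ u : ℝ, (t - u) ^ (p - 1) / Real.Gamma p * (u ^ (q - 1) / Real.Gamma q) =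
      1 / (Real.Gamma p * Real.Gamma q) * ((t - u) ^ (p - 1) * u ^ (q - 1)) := fun u => by
    field_simp
  simp_rw [h]
  rw [intervalIntegral.integral_const_mul, integral_sub_rpow_mul_rpow hp hq ht]
  have := Real.Gamma_pos_of_pos hp
  have := Real.Gamma_pos_of_pos hq
  field_simp

theorem intervalIntegrable_rpow_div_Gamma_mul {p q t : ℝ} (hp : 0 < p) (hq : 0 < q)
    (ht : 0 < t) : IntervalIntegrable
      (fun u => (t - u) ^ (p - 1) / Real.Gamma p * (u ^ (q - 1) / Real.Gamma q)) volume 0 t := by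
  have h : (fun u : ℝ => (t - u) ^ (p - 1) / Real.Gamma p * (u ^ (q - 1) / Real.Gamma q)) =
      fun u => 1 / (Real.Gamma p * Real.Gamma q) * ((t - u) ^ (p - 1) * u ^ (q - 1)) := by
    funext u
    field_simp
  rw [h]
  exact (intervalIntegrable_sub_rpow_mul_rpow hp hq ht).const_mul _

/-- Convolutions of the functions `mlFun` are given by Cauchy products of the coefficients. -/
theorem hasSum_integral_mlFun_mul (hα : 0 < α) (hx : 0 < x) (hy : 0 < y)
    (ha : ∀ n, |a n| ≤ 1) (hb : ∀ n, |b n| ≤ 1) {t : ℝ} (ht : 0 < t) :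
    HasSum (fun n : ℕ => (∑ p ∈ Finset.HasAntidiagonal.antidiagonal n, a p.1 * b p.2) *
        (t ^ (α * n + (x + y) - 1) / Real.Gamma (α * n + (x + y))))
      (∫ u in (0 : ℝ)..t, mlFun α x a (t - u) * mlFun α y b u) := by
  set K : ℕ × ℕ → ℝ := fun p =>
    t ^ (α * (p.1 + p.2 : ℕ) + (x + y) - 1) / Real.Gamma (α * (p.1 + p.2 : ℕ) + (x + y)) with hK
  have hK0 : ∀ p, 0 ≤ K p := fun p => by
    have := Real.Gamma_pos_of_pos (show 0 < α * (p.1 + p.2 : ℕ) + (x + y) by positivity)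
    positivity
  set F : ℕ × ℕ → ℝ → ℝ := fun p u =>
    a p.1 * ((t - u) ^ (α * p.1 + x - 1) / Real.Gamma (α * p.1 + x)) *
      (b p.2 * (u ^ (α * p.2 + y - 1) / Real.Gamma (α * p.2 + y))) with hF
  set F' : ℕ × ℕ → ℝ → ℝ := fun p u => (t - u) ^ (α * p.1 + x - 1) / Real.Gamma (α * p.1 + x) *
      (u ^ (α * p.2 + y - 1) / Real.Gamma (α * p.2 + y)) with hF'
  have hFF : ∀ p u, F p u = a p.1 * b p.2 * F' p u := fun p u => by simp only [hF, hF']; ring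
  have hF'int : ∀ p, IntervalIntegrable (F' p) volume 0 t := fun p =>
    intervalIntegrable_rpow_div_Gamma_mul (by positivity) (by positivity) ht
  have hF'val : ∀ p, ∫ u in (0 : ℝ)..t, F' p u = K p := fun p => by
    simp only [hF', hK]
    rw [integral_rpow_div_Gamma_mul (by positivity) (by positivity) ht]
    push_cast
    ring_nf
  have hF'0 : ∀ p, ∀ u ∈ Set.Ioc 0 t, 0 ≤ F' p u := fun p u hu => by
    have := Real.Gamma_pos_of_pos (show 0 < α * p.1 + x by positivity)
    have := Real.Gamma_pos_of_pos (show 0 < α * p.2 + y by positivity)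
    have := hu.1.le
    have : 0 ≤ t - u := sub_nonneg.2 hu.2
    positivity
  have hFint : ∀ p, Integrable (F p) (volume.restrict (Set.Ioc 0 t)) := fun p => by
    have := (hF'int p).const_mul (a p.1 * b p.2)
    rw [intervalIntegrable_iff_integrableOn_Ioc_of_le ht.le] at this
    simpa only [← hFF] using! this
  have hFnorm : ∀ p, ∫ u in Set.Ioc 0 t, ‖F p u‖ = |a p.1 * b p.2| * K p := fun p => by
    rw [← hF'val, intervalIntegral.integral_of_le ht.le, ← integral_const_mul]
    refine setIntegral_congr_fun measurableSet_Ioc fun u hu => ?_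
    simp only [hFF, Real.norm_eq_abs, abs_mul _ (F' p u), abs_of_nonneg (hF'0 p u hu)]
  have hab : ∀ p : ℕ × ℕ, |a p.1 * b p.2| ≤ 1 := fun p => by
    rw [abs_mul]
    exact mul_le_one₀ (ha _) (abs_nonneg _) (hb _)
  have hKsum : Summable K := by
    rw [← Finset.HasAntidiagonal.sigmaAntidiagonalEquivProd.summable_iff]
    refine (summable_sigma_of_nonneg fun _ => hK0 _).2 ⟨fun n => Summable.of_finite, ?_⟩
    have h1 : ∀ n : ℕ, (∑' p : Finset.HasAntidiagonal.antidiagonal n,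
        (K ∘ Finset.HasAntidiagonal.sigmaAntidiagonalEquivProd) ⟨n, p⟩) =
        t ^ (x + y - 1) * ((n + 1) * (t ^ α) ^ n / Real.Gamma (α * n + (x + y))) := fun n => by
      have h2 : ∀ p : Finset.HasAntidiagonal.antidiagonal n,
          (K ∘ Finset.HasAntidiagonal.sigmaAntidiagonalEquivProd) ⟨n, p⟩ =
          t ^ (α * n + (x + y) - 1) / Real.Gamma (α * n + (x + y)) := fun p => by
        have := Finset.HasAntidiagonal.mem_antidiagonal.1 p.2
        simp only [Function.comp, hK, Finset.HasAntidiagonal.sigmaAntidiagonalEquivProd_apply,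
          this]
      simp_rw [h2, tsum_fintype]
      simp only [Finset.sum_const, Finset.card_univ, Fintype.card_coe,
        Finset.Nat.card_antidiagonal, nsmul_eq_mul]
      rw [rpow_mul_mlSeries_term (x + y) (fun n => (n : ℝ) + 1) ht]
      push_cast
      ring
    refine (Summable.mul_left _ ?_).congr fun n => (h1 n).symm
    refine (summable_pow_div_Gamma hα (x := x + y) (2 * t ^ α)).of_nonneg_of_le
      (fun n => ?_) fun n => ?_
    all_goals have := Real.Gamma_pos_of_pos (show 0 < α * n + (x + y) by positivity)
    · positivity
    · rw [mul_pow]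
      gcongr
      exact_mod_cast Nat.lt_two_pow_self
  have hsum := hasSum_integral_of_summable_integral_norm (μ := volume.restrict (Set.Ioc 0 t))
    hFint (hKsum.of_nonneg_of_le (fun p => integral_nonneg fun u => norm_nonneg _) fun p => by
      rw [hFnorm]
      exact mul_le_of_le_one_left (hK0 p) (hab p))
  have hint : ∫ u in (0 : ℝ)..t, mlFun α x a (t - u) * mlFun α y b u =
      ∫ u in Set.Ioc 0 t, ∑' p, F p u := by
    rw [intervalIntegral.integral_of_le ht.le, integral_Ioc_eq_integral_Ioo,
      integral_Ioc_eq_integral_Ioo]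
    refine setIntegral_congr_fun measurableSet_Ioo fun u hu => ?_
    have h1 := hasSum_mlFun hα hx ha (sub_pos.2 hu.2)
    have h2 := hasSum_mlFun hα hy hb hu.1
    exact (h1.mul h2 (summable_mul_of_summable_norm h1.summable.norm h2.summable.norm)).tsum_eq.symm
  rw [hint]
  have hval : ∀ p, ∫ u in Set.Ioc 0 t, F p u = a p.1 * b p.2 * K p := fun p => by
    simp_rw [hFF]
    rw [integral_const_mul, ← intervalIntegral.integral_of_le ht.le, hF'val]
  simp_rw [hval] at hsum
  rw [← Finset.HasAntidiagonal.sigmaAntidiagonalEquivProd.hasSum_iff] at hsum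
  convert! hsum.sigma (fun n => hasSum_fintype _) using 1
  funext n
  rw [Finset.sum_mul, ← Finset.sum_coe_sort]
  refine Finset.sum_congr rfl fun p _ => ?_
  have := Finset.HasAntidiagonal.mem_antidiagonal.1 p.2
  simp only [Function.comp, hK, Finset.HasAntidiagonal.sigmaAntidiagonalEquivProd_apply, this]

end

noncomputable section

variable {α c : ℝ}

theorem abs_neg_pow_le_one (hc : |c| ≤ 1) (n : ℕ) : |(-c) ^ n| ≤ 1 := by
  rw [abs_pow, abs_neg]
  exact pow_le_one₀ (abs_nonneg c) hc

theorem abs_single_zero_le_one (n : ℕ) : |(Pi.single 0 1 : ℕ → ℝ) n| ≤ 1 := by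
  by_cases h : n = 0
  · simp [h]
  · simp [Pi.single_eq_of_ne h]

theorem mlFun_single_zero (α x u : ℝ) :
    mlFun α x (Pi.single 0 1) u = u ^ (x - 1) / Real.Gamma x := by
  rw [mlFun, mlSeries, tsum_eq_single 0 fun n hn => by simp [Pi.single_eq_of_ne hn]]
  simp [div_eq_mul_inv]

theorem sum_antidiagonal_single_zero_mul (b : ℕ → ℝ) (n : ℕ) :
    ∑ p ∈ Finset.HasAntidiagonal.antidiagonal n, (Pi.single 0 1 : ℕ → ℝ) p.1 * b p.2 = b n := by
  rw [Finset.sum_eq_single (0, n)]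
  · simp
  · rintro ⟨i, j⟩ hp hne
    have hij := Finset.HasAntidiagonal.mem_antidiagonal.1 hp
    have hi : i ≠ 0 := by
      rintro rfl
      exact hne (by simpa using hij)
    simp [Pi.single_eq_of_ne hi]
  · intro h
    exact absurd (Finset.HasAntidiagonal.mem_antidiagonal.2 (zero_add n)) h

theorem mittagLeffler_mul_rpow (α c t : ℝ) :
    mittagLeffler α (-c * t ^ α) = mlFun α 1 (fun n => (-c) ^ n) t := by
  simp [mittagLeffler, mlFun, mlSeries, ← mul_pow]

theorem mittagLeffler_zero (α : ℝ) : mittagLeffler α 0 = 1 := by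
  rw [mittagLeffler, tsum_eq_single 0 fun n hn => by simp [hn]]
  simp

theorem mittagLeffler_one (z : ℝ) : mittagLeffler 1 z = Real.exp z := by
  rw [mittagLeffler, Real.exp_eq_exp_ℝ, NormedSpace.exp_eq_tsum_div]
  simp [Real.Gamma_nat_eq_factorial]

theorem continuous_mittagLeffler_mul_rpow (hα : 0 < α) (hc : |c| ≤ 1) :
    Continuous fun t : ℝ => mittagLeffler α (-c * t ^ α) := by
  have h : (fun t : ℝ => mittagLeffler α (-c * t ^ α)) =
      fun t => mlSeries α 1 (fun n => (-c) ^ n) (t ^ α) := by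
    funext t
    simp [mittagLeffler, mlSeries, ← mul_pow]
  rw [h]
  exact (continuous_mlSeries hα one_pos (abs_neg_pow_le_one hc)).comp
    (Real.continuous_rpow_const hα.le)

theorem hasSum_mittagLeffler_succ (hα : 0 < α) (hc : |c| ≤ 1) {t : ℝ} (ht : 0 < t) :
    HasSum (fun n : ℕ => (-c) ^ (n + 1) * (t ^ (α * n + (1 + α) - 1) /
      Real.Gamma (α * n + (1 + α)))) (mittagLeffler α (-c * t ^ α) - 1) := by
  have h := hasSum_mlFun hα one_pos (abs_neg_pow_le_one hc) ht
  rw [← mittagLeffler_mul_rpow, ← hasSum_nat_add_iff' 1] at h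
  simp only [Finset.sum_range_one, pow_zero, one_mul, Nat.cast_zero, mul_zero, zero_add, sub_self,
    Real.rpow_zero, Real.Gamma_one, div_one] at h
  convert! h using 4 with n
  all_goals push_cast; ring_nf

/-- The integral of the relaxation density. -/
theorem mul_integral_mlFun (hα : 0 < α) (hc : |c| ≤ 1) {t : ℝ} (ht : 0 < t) :
    -c * ∫ u in (0 : ℝ)..t, mlFun α α (fun n => (-c) ^ n) u = mittagLeffler α (-c * t ^ α) - 1 := by
  have h := hasSum_integral_mlFun_mul hα one_pos hα abs_single_zero_le_one
    (abs_neg_pow_le_one hc) ht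
  simp only [sum_antidiagonal_single_zero_mul, mlFun_single_zero, sub_self, Real.rpow_zero,
    Real.Gamma_one, div_one, one_mul] at h
  refine (h.mul_left (-c)).unique ?_
  convert! hasSum_mittagLeffler_succ hα hc ht using 2 with n
  ring

theorem intervalIntegrable_mlFun (hα : 0 < α) (hc : |c| ≤ 1) {t : ℝ} (ht : 0 < t) :
    IntervalIntegrable (mlFun α α fun n => (-c) ^ n) volume 0 t := by
  have h := intervalIntegrable_mlFun_mul hα one_pos hα abs_single_zero_le_one
    (abs_neg_pow_le_one hc) ht
  simpa only [mlFun_single_zero, sub_self, Real.rpow_zero, Real.Gamma_one, div_one, one_mul] using h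

theorem hasDerivAt_mittagLeffler_mul_rpow (hα : 0 < α) (hc : |c| ≤ 1) {t : ℝ} (ht : 0 < t) :
    HasDerivAt (fun t : ℝ => mittagLeffler α (-c * t ^ α))
      (-c * mlFun α α (fun n => (-c) ^ n) t) t := by
  have hcont := continuousOn_mlFun hα hα (abs_neg_pow_le_one hc)
  have h1 := intervalIntegral.integral_hasDerivAt_right (intervalIntegrable_mlFun hα hc ht)
    (hcont.stronglyMeasurableAtFilter isOpen_Ioi t ht) (hcont.continuousAt (Ioi_mem_nhds ht))
  refine ((h1.const_mul (-c)).add_const 1).congr_of_eventuallyEq ?_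
  filter_upwards [Ioi_mem_nhds ht] with s hs
  rw [mul_integral_mlFun hα hc hs]
  ring

/-- The relaxation functions for the rates `1` and `c` are related by a renewal equation. -/
theorem mittagLeffler_renewal (hα : 0 < α) (hc : |c| ≤ 1) {t : ℝ} (ht : 0 < t) :
    mittagLeffler α (-c * t ^ α) = mittagLeffler α (-1 * t ^ α) +
      (1 - c) * ∫ u in (0 : ℝ)..t,
        mittagLeffler α (-c * (t - u) ^ α) * mlFun α α (fun n => (-1) ^ n) u := by
  have h1 : |(1 : ℝ)| ≤ 1 := by simp
  have h := hasSum_integral_mlFun_mul hα one_pos hα (abs_neg_pow_le_one hc)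
    (abs_neg_pow_le_one h1) ht
  simp only [← mittagLeffler_mul_rpow] at h
  have key : ∀ n : ℕ, (1 - c) * ∑ p ∈ Finset.HasAntidiagonal.antidiagonal n,
      (-c) ^ p.1 * (-1) ^ p.2 = (-c) ^ (n + 1) - (-1) ^ (n + 1) := fun n => by
    have hs := (Commute.all (-c) (-1)).geom_sum₂_mul (n + 1)
    rw [Finset.Nat.sum_antidiagonal_eq_sum_range_succ fun i j => (-c) ^ i * (-1) ^ j]
    simp only [Nat.add_sub_cancel] at hs
    rw [← hs]
    ring
  have h2 := (hasSum_mittagLeffler_succ hα hc ht).sub (hasSum_mittagLeffler_succ hα h1 ht)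
  simp only [← sub_mul, ← key, mul_assoc (1 - c)] at h2
  have h3 := (h.mul_left (1 - c)).unique h2
  linarith

theorem integral_rpow_mul_mlFun (hα : 0 < α) (hα1 : α < 1) (hc : |c| ≤ 1) {t : ℝ} (ht : 0 < t) :
    1 / Real.Gamma (1 - α) * ∫ u in (0 : ℝ)..t, (t - u) ^ (-α) * mlFun α α (fun n => (-c) ^ n) u =
      mittagLeffler α (-c * t ^ α) := by
  have h := hasSum_integral_mlFun_mul hα (sub_pos.2 hα1) hα abs_single_zero_le_one
    (abs_neg_pow_le_one hc) ht
  simp only [sum_antidiagonal_single_zero_mul, mlFun_single_zero, sub_add_cancel] at h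
  rw [mittagLeffler_mul_rpow, ← h.unique (hasSum_mlFun hα one_pos (abs_neg_pow_le_one hc) ht),
    ← intervalIntegral.integral_const_mul]
  refine intervalIntegral.integral_congr fun u _ => ?_
  simp only [show (1 - α - 1 : ℝ) = -α by ring]
  ring

/-- The Mittag-Leffler function solves the fractional relaxation problem. -/
theorem isFracRelaxation_mittagLeffler (hα : 0 < α) (hα1 : α < 1) (hc : |c| ≤ 1) {f : ℝ → ℝ}
    (hf : ∀ t, 0 ≤ t → f t = mittagLeffler α (-c * t ^ α)) : IsFracRelaxation α c f := by
  have hd : ∀ t, 0 < t → HasDerivAt f (-c * mlFun α α (fun n => (-c) ^ n) t) t := fun t ht =>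
    (hasDerivAt_mittagLeffler_mul_rpow hα hc ht).congr_of_eventuallyEq <| by
      filter_upwards [Ioi_mem_nhds ht] with s hs using hf s (le_of_lt hs)
  have hint : ∀ t, 0 < t → IntervalIntegrable
      (fun u => (t - u) ^ (-α) * mlFun α α (fun n => (-c) ^ n) u) volume 0 t := fun t ht => by
    have h := (intervalIntegrable_mlFun_mul hα (sub_pos.2 hα1) hα abs_single_zero_le_one
      (abs_neg_pow_le_one hc) ht).const_mul (Real.Gamma (1 - α))
    have hG := Real.Gamma_pos_of_pos (sub_pos.2 hα1)
    convert! h using 2 with u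
    rw [mlFun_single_zero, show (1 - α - 1 : ℝ) = -α by ring]
    field_simp
  have hae : ∀ t, ∀ u ∈ Set.Ioc 0 t, (t - u) ^ (-α) * deriv f u =
      -c * ((t - u) ^ (-α) * mlFun α α (fun n => (-c) ^ n) u) := fun t u hu => by
    rw [(hd u hu.1).deriv]
    ring
  refine ⟨?_, fun t ht => (hd t ht).differentiableAt, ?_, fun t ht => ?_, fun t ht => ?_⟩
  · exact (continuous_mittagLeffler_mul_rpow hα hc).continuousOn.congr fun t ht => hf t ht
  · rw [hf 0 le_rfl, Real.zero_rpow hα.ne', mul_zero, mittagLeffler_zero]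
  · refine ((hint t ht).const_mul (-c)).congr fun u hu => ?_
    rw [Set.uIoc_of_le ht.le] at hu
    exact (hae t u hu).symm
  · have h : ∫ u in (0 : ℝ)..t, (t - u) ^ (-α) * deriv f u =
        -c * ∫ u in (0 : ℝ)..t, (t - u) ^ (-α) * mlFun α α (fun n => (-c) ^ n) u := by
      rw [← intervalIntegral.integral_const_mul, intervalIntegral.integral_of_le ht.le,
        intervalIntegral.integral_of_le ht.le]
      exact setIntegral_congr_fun measurableSet_Ioc fun u hu => hae t u hu
    rw [caputoDeriv, h, hf t ht.le, ← integral_rpow_mul_mlFun hα hα1 hc ht]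
    ring

theorem integral_sub_rpow_mul_sub_rpow (hα : 0 < α) (hα1 : α < 1) {u t : ℝ} (hut : u < t) :
    ∫ v in u..t, (t - v) ^ (α - 1) * (v - u) ^ (-α) = Real.Gamma α * Real.Gamma (1 - α) := by
  have h := integral_sub_rpow_mul_rpow hα (sub_pos.2 hα1) (sub_pos.2 hut)
  rw [← sub_self u, ← intervalIntegral.integral_comp_sub_right] at h
  simpa [show (1 - α - 1 : ℝ) = -α by ring] using h

theorem intervalIntegrable_sub_rpow_mul_sub_rpow (hα : 0 < α) (hα1 : α < 1) {u t : ℝ}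
    (hut : u < t) :
    IntervalIntegrable (fun v => (t - v) ^ (α - 1) * (v - u) ^ (-α)) volume u t := by
  have h := (intervalIntegrable_sub_rpow_mul_rpow hα (sub_pos.2 hα1)
    (sub_pos.2 hut)).comp_sub_right u
  simpa [show (1 - α - 1 : ℝ) = -α by ring] using h

/-- The fractional integral of order `α` of the fractional integral of order `1 - α` is the
integral (Abel's inversion). -/
theorem integral_rpow_mul_integral_rpow_mul (hα : 0 < α) (hα1 : α < 1) {φ : ℝ → ℝ}
    (hφ : Measurable φ) {t : ℝ} (ht : 0 < t) (hint : IntervalIntegrable φ volume 0 t) :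
    ∫ v in (0 : ℝ)..t, (t - v) ^ (α - 1) * ∫ u in (0 : ℝ)..v, (v - u) ^ (-α) * φ u =
      Real.Gamma α * Real.Gamma (1 - α) * ∫ u in (0 : ℝ)..t, φ u := by
  set S : Set (ℝ × ℝ) := {p | 0 < p.1 ∧ p.1 < p.2 ∧ p.2 < t}
  have hS : MeasurableSet S :=
    ((measurableSet_lt measurable_const measurable_fst).inter
      ((measurableSet_lt measurable_fst measurable_snd).inter
        (measurableSet_lt measurable_snd measurable_const)))
  set F : ℝ × ℝ → ℝ := S.indicator fun p =>
    (t - p.2) ^ (α - 1) * (p.2 - p.1) ^ (-α) * φ p.1 with hF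
  have hFm : Measurable F := by
    refine Measurable.indicator ?_ hS
    fun_prop
  have hB := mul_pos (Real.Gamma_pos_of_pos hα) (Real.Gamma_pos_of_pos (sub_pos.2 hα1))
  set B := Real.Gamma α * Real.Gamma (1 - α)
  have hFu : ∀ u ∈ Set.Ioo 0 t, (fun v => F (u, v)) = (Set.Ioo u t).indicator
      fun v => (t - v) ^ (α - 1) * (v - u) ^ (-α) * φ u := fun u hu => by
    funext v
    simp only [hF, Set.indicator_apply, S, Set.mem_ofPred_eq, Set.mem_Ioo, hu.1, true_and]
  have hFu0 : ∀ u ∉ Set.Ioo 0 t, (fun v => F (u, v)) = fun _ => 0 := fun u hu => by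
    funext v
    refine Set.indicator_of_notMem (fun h => hu ⟨h.1, h.2.1.trans h.2.2⟩) _
  have hFv : ∀ v ∈ Set.Ioo 0 t, (fun u => F (u, v)) = (Set.Ioo 0 v).indicator
      fun u => (t - v) ^ (α - 1) * ((v - u) ^ (-α) * φ u) := fun v hv => by
    funext u
    simp only [hF, Set.indicator_apply, S, Set.mem_ofPred_eq, Set.mem_Ioo, hv.2, and_true,
      mul_assoc]
  have hFv0 : ∀ v ∉ Set.Ioo 0 t, (fun u => F (u, v)) = fun _ => 0 := fun v hv => by
    funext u
    refine Set.indicator_of_notMem (fun h => hv ⟨h.1.trans h.2.1, h.2.2⟩) _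
  have hIu : ∀ u ∈ Set.Ioo 0 t, IntegrableOn
      (fun v => (t - v) ^ (α - 1) * (v - u) ^ (-α) * φ u) (Set.Ioo u t) := fun u hu => by
    rw [← intervalIntegrable_iff_integrableOn_Ioo_of_le hu.2.le]
    exact (intervalIntegrable_sub_rpow_mul_sub_rpow hα hα1 hu.2).mul_const _
  have hval : ∀ u ∈ Set.Ioo 0 t, ∀ y : ℝ,
      ∫ v in Set.Ioo u t, (t - v) ^ (α - 1) * (v - u) ^ (-α) * y = B * y := fun u hu y => by
    rw [← integral_Ioc_eq_integral_Ioo, ← intervalIntegral.integral_of_le hu.2.le,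
      intervalIntegral.integral_mul_const, integral_sub_rpow_mul_sub_rpow hα hα1 hu.2]
  have hvalu : (fun u => ∫ v, F (u, v)) = (Set.Ioo 0 t).indicator fun u => B * φ u := by
    funext u
    by_cases hu : u ∈ Set.Ioo 0 t
    · rw [hFu u hu, integral_indicator measurableSet_Ioo, hval u hu, Set.indicator_of_mem hu]
    · rw [hFu0 u hu, Set.indicator_of_notMem hu, integral_zero]
  have hnorm : (fun u => ∫ v, ‖F (u, v)‖) = (Set.Ioo 0 t).indicator fun u => B * |φ u| := by
    funext u
    by_cases hu : u ∈ Set.Ioo 0 t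
    · rw [Set.indicator_of_mem hu, ← hval u hu, ← integral_indicator measurableSet_Ioo]
      refine integral_congr_ae (ae_of_all _ fun v => ?_)
      simp only [congrFun (hFu u hu) v, Set.indicator_apply]
      split_ifs with hv
      · have h1 : 0 < t - v := sub_pos.2 hv.2
        have h2 : 0 < v - u := sub_pos.2 hv.1
        rw [Real.norm_eq_abs, abs_mul, abs_of_pos (by positivity)]
      · simp
    · simp [congrFun (hFu0 u hu), Set.indicator_of_notMem hu]
  rw [intervalIntegrable_iff_integrableOn_Ioo_of_le ht.le] at hint
  have hFint : Integrable F (volume.prod volume) := by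
    rw [integrable_prod_iff hFm.aestronglyMeasurable]
    refine ⟨ae_of_all _ fun u => ?_, ?_⟩
    · by_cases hu : u ∈ Set.Ioo 0 t
      · rw [hFu u hu, integrable_indicator_iff measurableSet_Ioo]
        exact hIu u hu
      · rw [hFu0 u hu]
        exact integrable_zero _ _ _
    · rw [hnorm, integrable_indicator_iff measurableSet_Ioo]
      exact (hint.abs).const_mul B
  have hswap := integral_integral_swap (f := fun u v => F (u, v)) hFint
  rw [hvalu, integral_indicator measurableSet_Ioo, integral_const_mul] at hswap
  rw [intervalIntegral.integral_of_le ht.le, intervalIntegral.integral_of_le ht.le,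
    integral_Ioc_eq_integral_Ioo, integral_Ioc_eq_integral_Ioo, hswap,
    ← integral_indicator measurableSet_Ioo]
  congr 1
  funext v
  by_cases hv : v ∈ Set.Ioo 0 t
  · rw [Set.indicator_of_mem hv, hFv v hv, integral_indicator measurableSet_Ioo,
      intervalIntegral.integral_of_le hv.1.le, integral_Ioc_eq_integral_Ioo, integral_const_mul]
  · rw [Set.indicator_of_notMem hv, hFv0 v hv, integral_zero]

/-- A solution of the fractional relaxation problem solves the equivalent Volterra equation. -/
theorem IsFracRelaxation.volterra (hα : 0 < α) (hα1 : α < 1) {g : ℝ → ℝ}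
    (hg : IsFracRelaxation α c g) {t : ℝ} (ht : 0 < t) :
    g t = 1 - c / Real.Gamma α * ∫ v in (0 : ℝ)..t, (t - v) ^ (α - 1) * g v := by
  have hG1 := Real.Gamma_pos_of_pos hα
  have hG2 := Real.Gamma_pos_of_pos (sub_pos.2 hα1)
  have hint : IntervalIntegrable (deriv g) volume 0 t := by
    have h := (hg.integrable t ht).mul_continuousOn (g := fun u => (t - u) ^ α)
      ((by fun_prop : Continuous fun u : ℝ => t - u).rpow_const
        fun _ => Or.inr hα.le).continuousOn
    rw [intervalIntegrable_iff_integrableOn_Ioo_of_le ht.le] at h ⊢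
    refine h.congr_fun (fun u hu => ?_) measurableSet_Ioo
    have h1 : (t - u) ^ (-α) * (t - u) ^ α = 1 := by
      rw [← Real.rpow_add (sub_pos.2 hu.2), neg_add_cancel, Real.rpow_zero]
    simp only
    rw [mul_right_comm, h1, one_mul]
  have hftc : ∫ u in (0 : ℝ)..t, deriv g u = g t - g 0 :=
    intervalIntegral.integral_eq_sub_of_hasDerivAt_of_le ht.le
      (hg.continuousOn.mono fun u hu => hu.1)
      (fun u hu => (hg.differentiableAt u hu.1).hasDerivAt) hint
  have habel := integral_rpow_mul_integral_rpow_mul hα hα1 (measurable_deriv g) ht hint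
  have hin : ∀ v ∈ Set.Ioc 0 t, (t - v) ^ (α - 1) * ∫ u in (0 : ℝ)..v, (v - u) ^ (-α) * deriv g u =
      -c * Real.Gamma (1 - α) * ((t - v) ^ (α - 1) * g v) := fun v hv => by
    have h := hg.equation v hv.1
    rw [caputoDeriv] at h
    field_simp at h
    rw [h]
    ring
  rw [intervalIntegral.integral_of_le ht.le, setIntegral_congr_fun measurableSet_Ioc hin,
    integral_const_mul, ← intervalIntegral.integral_of_le ht.le, hftc, hg.initial] at habel
  field_simp
  have := mul_right_cancel₀ hG2.ne' (show
    (-c * ∫ v in (0 : ℝ)..t, (t - v) ^ (α - 1) * g v) * Real.Gamma (1 - α) =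
      (Real.Gamma α * (g t - 1)) * Real.Gamma (1 - α) by linear_combination habel)
  linear_combination -this

theorem intervalIntegrable_rpow_mul_of_continuousOn (hα : 0 < α) {g : ℝ → ℝ} {t : ℝ} (ht : 0 < t)
    (hg : ContinuousOn g (Set.Ici 0)) :
    IntervalIntegrable (fun v => (t - v) ^ (α - 1) * g v) volume 0 t := by
  have h := intervalIntegrable_sub_rpow_mul_rpow hα one_pos ht
  simp only [sub_self, Real.rpow_zero, mul_one] at h
  refine h.mul_continuousOn (hg.mono fun u hu => ?_)
  rw [Set.uIcc_of_le ht.le] at hu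
  exact hu.1

/-- A continuous solution of the homogeneous Volterra equation vanishes. -/
theorem eq_zero_of_volterra (hα : 0 < α) (hc : |c| ≤ 1) {h : ℝ → ℝ}
    (hcont : ContinuousOn h (Set.Ici 0))
    (heq : ∀ t, 0 < t →
      h t = -(c / Real.Gamma α) * ∫ v in (0 : ℝ)..t, (t - v) ^ (α - 1) * h v)
    {T : ℝ} (hT : 0 < T) : h T = 0 := by
  have hG := Real.Gamma_pos_of_pos hα
  obtain ⟨M, hM⟩ := isCompact_Icc.exists_bound_of_continuousOn
    (hcont.mono fun u (hu : u ∈ Set.Icc 0 T) => hu.1)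
  have hM0 : 0 ≤ M := (norm_nonneg _).trans (hM T ⟨hT.le, le_rfl⟩)
  have key : ∀ n : ℕ, ∀ t ∈ Set.Ioc 0 T,
      |h t| ≤ M * (t ^ (α * n + 1 - 1) / Real.Gamma (α * n + 1)) := fun n => by
    induction n with
    | zero => exact fun t ht => by simpa using hM t ⟨ht.1.le, ht.2⟩
    | succ n ih =>
      intro t ht
      have hn : 0 < α * n + 1 := by positivity
      have hb : |∫ v in (0 : ℝ)..t, (t - v) ^ (α - 1) / Real.Gamma α * h v| ≤
          ∫ v in (0 : ℝ)..t, (t - v) ^ (α - 1) / Real.Gamma α *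
            (v ^ (α * n + 1 - 1) / Real.Gamma (α * n + 1)) * M := by
        rw [← Real.norm_eq_abs]
        refine intervalIntegral.norm_integral_le_of_norm_le ht.1.le ?_
          ((intervalIntegrable_rpow_div_Gamma_mul hα hn ht.1).mul_const _)
        refine ae_of_all _ fun v hv => ?_
        have h1 := ih v ⟨hv.1, hv.2.trans ht.2⟩
        have h2 : 0 ≤ t - v := sub_nonneg.2 hv.2
        rw [Real.norm_eq_abs, abs_mul, abs_of_nonneg (by positivity), mul_assoc,
          mul_comm _ M]
        gcongr
      rw [intervalIntegral.integral_mul_const, integral_rpow_div_Gamma_mul hα hn ht.1] at hb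
      have he : h t = -c * ∫ v in (0 : ℝ)..t, (t - v) ^ (α - 1) / Real.Gamma α * h v := by
        rw [heq t ht.1, ← intervalIntegral.integral_const_mul,
          ← intervalIntegral.integral_const_mul]
        congr 1
        funext v
        ring
      rw [he, abs_mul, abs_neg]
      refine (mul_le_of_le_one_left (abs_nonneg _) hc).trans (hb.trans_eq ?_)
      push_cast
      ring_nf
  have hlim : Filter.Tendsto
      (fun n : ℕ => M * (T ^ (α * n + 1 - 1) / Real.Gamma (α * n + 1))) Filter.atTop (nhds 0) := by
    have h1 := ((summable_pow_div_Gamma hα (x := 1) (T ^ α)).tendsto_atTop_zero).const_mul M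
    rw [mul_zero] at h1
    refine h1.congr fun n => ?_
    rw [add_sub_cancel_right, Real.rpow_mul hT.le, Real.rpow_natCast]
  have := ge_of_tendsto' hlim fun n => key n T ⟨hT, le_rfl⟩
  exact abs_nonpos_iff.1 this

/-- Uniqueness for the fractional relaxation problem. -/
theorem IsFracRelaxation.unique (hα : 0 < α) (hα1 : α < 1) (hc : |c| ≤ 1) {f g : ℝ → ℝ}
    (hf : IsFracRelaxation α c f) (hg : IsFracRelaxation α c g) {t : ℝ} (ht : 0 ≤ t) :
    f t = g t := by
  rcases ht.eq_or_lt with rfl | ht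
  · rw [hf.initial, hg.initial]
  · refine sub_eq_zero.1 (eq_zero_of_volterra (h := fun s => f s - g s) hα hc
      (hf.continuousOn.sub hg.continuousOn) (fun s hs => ?_) ht)
    simp only [mul_sub]
    rw [intervalIntegral.integral_sub
      (intervalIntegrable_rpow_mul_of_continuousOn hα hs hf.continuousOn)
      (intervalIntegrable_rpow_mul_of_continuousOn hα hs hg.continuousOn),
      hf.volterra hα hα1 hs, hg.volterra hα hα1 hs]
    ring

end

noncomputable section

variable {Ω : Type*} {X J : ℕ → Ω → ℝ} {α c : ℝ}

theorem epoch_succ (J : ℕ → Ω → ℝ) (n : ℕ) (ω : Ω) : epoch J (n + 1) ω = epoch J n ω + J n ω :=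
  Finset.sum_range_succ _ _

theorem epoch_zero (J : ℕ → Ω → ℝ) (ω : Ω) : epoch J 0 ω = 0 := by
  simp [epoch]

theorem monotone_epoch {ω : Ω} (h : ∀ i, 0 < J i ω) : Monotone fun n => epoch J n ω :=
  monotone_nat_of_le_succ fun n => by
    rw [epoch_succ]
    linarith [h n]

theorem isGreatest_renewalCount {ω : Ω} (hpos : ∀ i, 0 < J i ω)
    (hub : ∀ t : ℝ, ∃ n, t < epoch J n ω) {t : ℝ} (ht : 0 ≤ t) :
    IsGreatest {n : ℕ | epoch J n ω ≤ t} (renewalCount J t ω) := by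
  obtain ⟨n, hn⟩ := hub t
  have hbdd : BddAbove {n : ℕ | epoch J n ω ≤ t} :=
    ⟨n, fun m hm => not_lt.1 fun hnm =>
      absurd ((monotone_epoch hpos hnm.le).trans hm) (not_le.2 hn)⟩
  exact ⟨Nat.sSup_mem ⟨0, by simpa [epoch_zero] using ht⟩ hbdd, fun m hm => le_csSup hbdd hm⟩

theorem renewalCount_eq_iff {ω : Ω} (hpos : ∀ i, 0 < J i ω)
    (hub : ∀ t : ℝ, ∃ n, t < epoch J n ω) {t : ℝ} (ht : 0 ≤ t) (k : ℕ) :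
    renewalCount J t ω = k ↔ epoch J k ω ≤ t ∧ ¬ epoch J (k + 1) ω ≤ t := by
  have h := isGreatest_renewalCount hpos hub ht
  constructor
  · rintro rfl
    exact ⟨h.1, fun h1 => absurd (h.2 h1) (by simp)⟩
  · rintro ⟨h1, h2⟩
    refine le_antisymm (not_lt.1 fun hlt => h2 ?_) (h.2 h1)
    exact (monotone_epoch hpos (Nat.succ_le_of_lt hlt)).trans h.1

theorem maxStat_le_iff {e : EReal} {w : ℝ} (he : e ≤ (w : EReal)) (x : ℕ → ℝ) (n : ℕ) :
    maxStat e x n ≤ (w : EReal) ↔ ∀ i ∈ Finset.range n, x i ≤ w := by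
  rw [maxStat]
  split_ifs with h
  · simp [h, he]
  · simp only [Finset.sup_le_iff, EReal.coe_le_coe_iff]

theorem gumbelCDF_log_div {r : ℝ} (hr : 0 < r) (w : ℝ) {t : ℝ} (ht : 0 < t) :
    gumbelCDF (Real.log t / r) (1 / r) w = Real.exp (-(Real.exp (-(r * w)) * t)) := by
  have h : -(w - Real.log t / r) / (1 / r) = -(r * w) + Real.log t := by
    field_simp
    ring
  rw [gumbelCDF, h, Real.exp_add, Real.exp_log ht]

/-- The density `-d/dt E_α(-t ^ α)` of the Mittag-Leffler waiting times. -/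
def waitingDensity (α t : ℝ) : ℝ :=
  mlFun α α (fun n => (-1) ^ n) t

theorem integral_waitingDensity (hα : 0 < α) {t : ℝ} (ht : 0 ≤ t) :
    ∫ u in (0 : ℝ)..t, waitingDensity α u = 1 - mittagLeffler α (-(t ^ α)) := by
  rcases ht.eq_or_lt with rfl | ht
  · simp [Real.zero_rpow hα.ne', mittagLeffler_zero]
  · have h := mul_integral_mlFun (c := 1) hα (by simp) ht
    simp only [neg_mul, one_mul] at h
    simp only [waitingDensity]
    linarith

theorem intervalIntegrable_waitingDensity (hα : 0 < α) {t : ℝ} (ht : 0 ≤ t) :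
    IntervalIntegrable (waitingDensity α) volume 0 t := by
  rcases ht.eq_or_lt with rfl | ht
  · exact IntervalIntegrable.refl
  · exact intervalIntegrable_mlFun (c := 1) hα (by simp) ht

theorem aemeasurable_waitingDensity (hα : 0 < α) :
    AEMeasurable (waitingDensity α) (volume.restrict (Set.Ioi 0)) :=
  (continuousOn_mlFun hα hα (abs_neg_pow_le_one (c := 1) (by simp))).aemeasurable measurableSet_Ioi

variable [MeasurableSpace Ω] {μ : Measure Ω}

theorem measurable_epoch (hJ : ∀ i, Measurable (J i)) (n : ℕ) : Measurable (epoch J n) :=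
  Finset.measurable_fun_sum _ fun i _ => hJ i

/-- The distribution function of the `n`-th epoch. -/
def epochCDF (μ : Measure Ω) (J : ℕ → Ω → ℝ) (n : ℕ) (t : ℝ) : ℝ :=
  μ.real {ω | epoch J n ω ≤ t}

theorem epochCDF_nonneg (n : ℕ) (t : ℝ) : 0 ≤ epochCDF μ J n t := measureReal_nonneg

theorem renewalCount_preimage_ae_eq (hpos : ∀ᵐ ω ∂μ, ∀ i, 0 < J i ω)
    (hub : ∀ᵐ ω ∂μ, ∀ t : ℝ, ∃ n, t < epoch J n ω) {t : ℝ} (ht : 0 ≤ t) (k : ℕ) :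
    (renewalCount J t ⁻¹' {k} : Set Ω) =ᵐ[μ]
      ({ω | epoch J k ω ≤ t} \ {ω | epoch J (k + 1) ω ≤ t} : Set Ω) := by
  filter_upwards [hpos, hub] with ω h1 h2
  exact propext (renewalCount_eq_iff h1 h2 ht k)

theorem real_le_of_map_eq_expMeasure {Y : Ω → ℝ} (hY : Measurable Y) {r w : ℝ} (hr : 0 < r)
    (hlaw : μ.map Y = expMeasure r) (hw : 0 ≤ w) :
    μ.real {ω | Y ω ≤ w} = 1 - Real.exp (-(r * w)) := by
  have hprob : IsProbabilityMeasure (expMeasure r) := isProbabilityMeasure_expMeasure hr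
  have h := cdf_expMeasure_eq hr w
  rw [cdf_eq_real, if_pos hw, ← hlaw, map_measureReal_apply hY measurableSet_Iic] at h
  exact h

theorem epochCDF_of_neg (hpos : ∀ᵐ ω ∂μ, ∀ i, 0 < J i ω) (n : ℕ) {t : ℝ} (ht : t < 0) :
    epochCDF μ J n t = 0 := by
  rw [epochCDF, measureReal_def, ENNReal.toReal_eq_zero_iff]
  refine Or.inl (measure_mono_null ?_ hpos)
  intro ω hω h
  have h0 := monotone_epoch h (Nat.zero_le n)
  simp only [epoch_zero] at h0
  exact absurd (h0.trans hω) (not_le.2 ht)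

theorem nullMeasurableSet_renewalCount_preimage (hJ : ∀ i, Measurable (J i))
    (hpos : ∀ᵐ ω ∂μ, ∀ i, 0 < J i ω) (hub : ∀ᵐ ω ∂μ, ∀ t : ℝ, ∃ n, t < epoch J n ω)
    {t : ℝ} (ht : 0 ≤ t) (k : ℕ) : NullMeasurableSet (renewalCount J t ⁻¹' {k}) μ :=
  ((measurableSet_le (measurable_epoch hJ k) measurable_const).diff
    (measurableSet_le (measurable_epoch hJ (k + 1)) measurable_const)).nullMeasurableSet.congr
    (renewalCount_preimage_ae_eq hpos hub ht k).symm

variable [IsProbabilityMeasure μ]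

theorem real_le_eq_one_sub_mittagLeffler {Y : Ω → ℝ} (hY : Measurable Y)
    (hlaw : ∀ t : ℝ, 0 ≤ t → μ.real {ω | t < Y ω} = mittagLeffler α (-(t ^ α)))
    {t : ℝ} (ht : 0 ≤ t) : μ.real {ω | Y ω ≤ t} = 1 - mittagLeffler α (-(t ^ α)) := by
  rw [← hlaw t ht, ← probReal_compl_eq_one_sub (measurableSet_lt measurable_const hY)]
  congr 1
  ext ω
  simp

theorem waitingDensity_nonneg {Y : Ω → ℝ} (hα : 0 < α)
    (hlaw : ∀ t : ℝ, 0 ≤ t → μ.real {ω | t < Y ω} = mittagLeffler α (-(t ^ α)))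
    {t : ℝ} (ht : 0 < t) : 0 ≤ waitingDensity α t := by
  have hmono : MonotoneOn (fun t : ℝ => -mittagLeffler α (-1 * t ^ α)) (Set.Ioi 0) := by
    intro s hs u hu hsu
    simp only [neg_mul, one_mul, ← hlaw s (le_of_lt hs), ← hlaw u (le_of_lt hu)]
    exact neg_le_neg (measureReal_mono fun ω (hω : u < Y ω) => hsu.trans_lt hω)
  have h := hmono.derivWithin_nonneg (x := t)
  rw [derivWithin_of_isOpen isOpen_Ioi ht,
    (hasDerivAt_mittagLeffler_mul_rpow (c := 1) hα (by simp) ht).fun_neg.deriv] at h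
  simpa [waitingDensity] using h

theorem ae_pos_of_law {Y : Ω → ℝ} (hY : Measurable Y) (hα : 0 < α)
    (hlaw : ∀ t : ℝ, 0 ≤ t → μ.real {ω | t < Y ω} = mittagLeffler α (-(t ^ α))) :
    ∀ᵐ ω ∂μ, 0 < Y ω := by
  have h := hlaw 0 le_rfl
  rw [Real.zero_rpow hα.ne', neg_zero, mittagLeffler_zero, measureReal_def,
    ENNReal.toReal_eq_one_iff] at h
  exact (prob_compl_eq_zero_iff (measurableSet_lt measurable_const hY)).2 h

/-- The waiting times have the density `waitingDensity α` on the half-line. -/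
theorem map_eq_withDensity {Y : Ω → ℝ} (hY : Measurable Y) (hα : 0 < α)
    (hlaw : ∀ t : ℝ, 0 ≤ t → μ.real {ω | t < Y ω} = mittagLeffler α (-(t ^ α))) :
    μ.map Y = (volume.restrict (Set.Ioi 0)).withDensity
      fun u => ENNReal.ofReal (waitingDensity α u) := by
  have hprob : IsProbabilityMeasure (μ.map Y) := Measure.isProbabilityMeasure_map hY.aemeasurable
  set ν := (volume.restrict (Set.Ioi (0 : ℝ))).withDensity
    fun u => ENNReal.ofReal (waitingDensity α u) with hν
  have hIic : ∀ t, μ.map Y (Set.Iic t) = ν (Set.Iic t) := fun t => by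
    rw [Measure.map_apply hY measurableSet_Iic, hν, withDensity_apply _ measurableSet_Iic,
      Measure.restrict_restrict measurableSet_Iic, Set.inter_comm, Set.Ioi_inter_Iic]
    rcases lt_or_ge t 0 with ht | ht
    · rw [Set.Ioc_eq_empty (not_lt.2 ht.le), Measure.restrict_empty, lintegral_zero_measure]
      refine measure_mono_null (fun ω hω => ?_) (ae_pos_of_law hY hα hlaw)
      exact fun h => absurd (lt_of_lt_of_le h hω) (not_lt.2 ht.le)
    · rw [← ofReal_integral_eq_lintegral_ofReal, ← intervalIntegral.integral_of_le ht,
        integral_waitingDensity hα ht, ← real_le_eq_one_sub_mittagLeffler hY hlaw ht,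
        ofReal_measureReal]
      · rfl
      · exact (intervalIntegrable_iff_integrableOn_Ioc_of_le ht).1
          (intervalIntegrable_waitingDensity hα ht)
      · exact ae_restrict_of_forall_mem measurableSet_Ioc fun u hu =>
          waitingDensity_nonneg hα hlaw hu.1
  refine Measure.ext_of_Ioc _ _ fun a b hab => ?_
  rw [← Set.Iic_sdiff_Iic, measure_sdiff (Set.Iic_subset_Iic.2 hab.le) nullMeasurableSet_Iic
    (measure_ne_top _ _), measure_sdiff (Set.Iic_subset_Iic.2 hab.le) nullMeasurableSet_Iic
    (hIic a ▸ measure_ne_top _ _), hIic, hIic]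

theorem epochCDF_le_one (n : ℕ) (t : ℝ) : epochCDF μ J n t ≤ 1 := measureReal_le_one

theorem monotone_epochCDF (n : ℕ) : Monotone (epochCDF μ J n) := fun _ _ hst =>
  measureReal_mono fun _ hω => le_trans hω hst

theorem epochCDF_zero {t : ℝ} (ht : 0 ≤ t) : epochCDF μ J 0 t = 1 := by
  simp [epochCDF, epoch_zero, ht]

theorem epochCDF_succ_eq_integral_map (hJ : ∀ i, Measurable (J i)) (hindep : iIndepFun J μ)
    (n : ℕ) (t : ℝ) :
    epochCDF μ J (n + 1) t = ∫ u, epochCDF μ J n (t - u) ∂(μ.map (J n)) := by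
  have hT := measurable_epoch hJ n
  have hprob : IsProbabilityMeasure (μ.map (J n)) :=
    Measure.isProbabilityMeasure_map (hJ n).aemeasurable
  have hprob' : IsProbabilityMeasure (μ.map (epoch J n)) :=
    Measure.isProbabilityMeasure_map hT.aemeasurable
  have hind : IndepFun (epoch J n) (J n) μ := by
    have h := hindep.indepFun_sum_range_succ hJ n
    convert! h using 1
    funext ω
    simp [epoch]
  have hprod := (indepFun_iff_map_prod_eq_prod_map_map hT.aemeasurable (hJ n).aemeasurable).1 hind
  have hS : MeasurableSet {p : ℝ × ℝ | p.1 + p.2 ≤ t} :=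
    measurableSet_le (by fun_prop) measurable_const
  have h1 : μ {ω | epoch J (n + 1) ω ≤ t} =
      ∫⁻ u, μ {ω | epoch J n ω ≤ t - u} ∂(μ.map (J n)) := by
    have h2 : {ω | epoch J (n + 1) ω ≤ t} =
        (fun ω => (epoch J n ω, J n ω)) ⁻¹' {p : ℝ × ℝ | p.1 + p.2 ≤ t} := by
      ext ω
      simp [epoch_succ]
    rw [h2, ← Measure.map_apply (hT.prodMk (hJ n)) hS, hprod, Measure.prod_apply_symm hS]
    refine lintegral_congr fun u => ?_
    have h3 : (fun x => (x, u)) ⁻¹' {p : ℝ × ℝ | p.1 + p.2 ≤ t} = Set.Iic (t - u) := by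
      ext x
      simp [le_sub_iff_add_le]
    rw [h3, Measure.map_apply hT measurableSet_Iic]
    rfl
  simp only [epochCDF, measureReal_def]
  rw [h1, integral_toReal _ (ae_of_all _ fun u => measure_lt_top _ _)]
  refine Antitone.measurable (fun u v huv => measure_mono ?_) |>.aemeasurable
  exact fun ω (hω : epoch J n ω ≤ t - v) => hω.trans (by linarith)

/-- The renewal recursion for the distribution functions of the epochs. -/
theorem epochCDF_succ (hα : 0 < α) (hJ : ∀ i, Measurable (J i)) (hindep : iIndepFun J μ)
    (hident : ∀ i, IdentDistrib (J i) (J 0) μ μ)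
    (hlaw : ∀ t : ℝ, 0 ≤ t → μ.real {ω | t < J 0 ω} = mittagLeffler α (-(t ^ α)))
    (hpos : ∀ᵐ ω ∂μ, ∀ i, 0 < J i ω) (n : ℕ) {t : ℝ} (ht : 0 ≤ t) :
    epochCDF μ J (n + 1) t = ∫ u in (0 : ℝ)..t, epochCDF μ J n (t - u) * waitingDensity α u := by
  rw [epochCDF_succ_eq_integral_map hJ hindep, (hident n).map_eq,
    map_eq_withDensity (hJ 0) hα hlaw, integral_withDensity_eq_integral_toReal_smul₀
      (aemeasurable_waitingDensity hα).ennreal_ofReal (ae_of_all _ fun u => ENNReal.ofReal_lt_top),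
    setIntegral_eq_of_subset_of_forall_sdiff_eq_zero (s := Set.Ioc 0 t) measurableSet_Ioi
      (fun u hu => hu.1), intervalIntegral.integral_of_le ht]
  · refine setIntegral_congr_fun measurableSet_Ioc fun u hu => ?_
    simp only [ENNReal.toReal_ofReal (waitingDensity_nonneg hα hlaw hu.1), smul_eq_mul,
      mul_comm]
  · intro u hu
    have htu : t < u := not_le.1 fun h => hu.2 ⟨hu.1, h⟩
    rw [epochCDF_of_neg hpos n (sub_neg.2 htu), smul_zero]

theorem intervalIntegrable_epochCDF_mul (hα : 0 < α) (n : ℕ) {t : ℝ} (ht : 0 ≤ t) :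
    IntervalIntegrable (fun u => epochCDF μ J n (t - u) * waitingDensity α u) volume 0 t := by
  have h := intervalIntegrable_waitingDensity hα ht
  rw [intervalIntegrable_iff_integrableOn_Ioc_of_le ht] at h ⊢
  refine Integrable.bdd_mul (c := 1) h ?_ (ae_of_all _ fun u => ?_)
  · exact ((monotone_epochCDF n).measurable.comp
      (measurable_const.sub measurable_id)).aestronglyMeasurable
  · rw [Real.norm_eq_abs, abs_of_nonneg (epochCDF_nonneg _ _)]
    exact epochCDF_le_one _ _

/-- The partial sums of the probability generating function of the renewal count converge
geometrically to a Mittag-Leffler function. -/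
theorem abs_mittagLeffler_sub_sum_le (hα : 0 < α) (hc0 : 0 ≤ c) (hc1 : c ≤ 1)
    (hJ : ∀ i, Measurable (J i)) (hindep : iIndepFun J μ)
    (hident : ∀ i, IdentDistrib (J i) (J 0) μ μ)
    (hlaw : ∀ t : ℝ, 0 ≤ t → μ.real {ω | t < J 0 ω} = mittagLeffler α (-(t ^ α)))
    (hpos : ∀ᵐ ω ∂μ, ∀ i, 0 < J i ω) {T M : ℝ}
    (hM : ∀ t ∈ Set.Icc 0 T, |mittagLeffler α (-c * t ^ α)| ≤ M) (n : ℕ) :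
    ∀ t ∈ Set.Icc 0 T, |mittagLeffler α (-c * t ^ α) - ∑ k ∈ Finset.range n,
      (epochCDF μ J k t - epochCDF μ J (k + 1) t) * (1 - c) ^ k| ≤ (1 - c) ^ n * M := by
  have hcabs : |c| ≤ 1 := abs_le.2 ⟨by linarith, hc1⟩
  have hs : 0 ≤ 1 - c := sub_nonneg.2 hc1
  have hint := fun (n : ℕ) {t : ℝ} (ht : 0 ≤ t) =>
    intervalIntegrable_epochCDF_mul (μ := μ) (J := J) hα n ht
  have hrec := fun (n : ℕ) {t : ℝ} (ht : 0 ≤ t) =>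
    epochCDF_succ hα hJ hindep hident hlaw hpos n ht
  induction n with
  | zero => simpa using hM
  | succ n ih =>
    intro t ht
    have hM0 : 0 ≤ M := (abs_nonneg _).trans (hM t ht)
    have hfint : IntervalIntegrable (fun u => mittagLeffler α (-c * (t - u) ^ α) *
        waitingDensity α u) volume 0 t :=
      (intervalIntegrable_waitingDensity hα ht.1).continuousOn_mul
        ((continuous_mittagLeffler_mul_rpow hα hcabs).comp
          (continuous_const.sub continuous_id)).continuousOn
    have hkey : mittagLeffler α (-c * t ^ α) - ∑ k ∈ Finset.range (n + 1),
        (epochCDF μ J k t - epochCDF μ J (k + 1) t) * (1 - c) ^ k =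
        (1 - c) * ∫ u in (0 : ℝ)..t, (mittagLeffler α (-c * (t - u) ^ α) -
          ∑ k ∈ Finset.range n, (epochCDF μ J k (t - u) - epochCDF μ J (k + 1) (t - u)) *
            (1 - c) ^ k) * waitingDensity α u := by
      have h1 : mittagLeffler α (-c * t ^ α) = mittagLeffler α (-(t ^ α)) + (1 - c) *
          ∫ u in (0 : ℝ)..t, mittagLeffler α (-c * (t - u) ^ α) * waitingDensity α u := by
        rcases ht.1.eq_or_lt with h0 | h0
        · simp [← h0, Real.zero_rpow hα.ne']
        · simpa [waitingDensity] using! mittagLeffler_renewal hα hcabs h0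
      have h2 : epochCDF μ J 0 t - epochCDF μ J 1 t = mittagLeffler α (-(t ^ α)) := by
        rw [epochCDF_zero ht.1, epochCDF]
        simp only [epoch, Finset.sum_range_one]
        rw [real_le_eq_one_sub_mittagLeffler (hJ 0) hlaw ht.1]
        ring
      have h3 : ∀ k, (epochCDF μ J (k + 1) t - epochCDF μ J (k + 1 + 1) t) * (1 - c) ^ (k + 1) =
          (1 - c) * ∫ u in (0 : ℝ)..t, (epochCDF μ J k (t - u) - epochCDF μ J (k + 1) (t - u)) *
            (1 - c) ^ k * waitingDensity α u := fun k => by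
        rw [hrec k ht.1, hrec (k + 1) ht.1, ← intervalIntegral.integral_sub (hint k ht.1)
          (hint (k + 1) ht.1), ← intervalIntegral.integral_mul_const,
          ← intervalIntegral.integral_const_mul]
        congr 1
        funext u
        ring
      have h4 : ∀ k ∈ Finset.range n, IntervalIntegrable (fun u => (epochCDF μ J k (t - u) -
          epochCDF μ J (k + 1) (t - u)) * (1 - c) ^ k * waitingDensity α u) volume 0 t :=
        fun k _ => by
          convert! ((hint k ht.1).sub (hint (k + 1) ht.1)).mul_const ((1 - c) ^ k) using 2 with u
          ring
      simp only [sub_mul (mittagLeffler α _), Finset.sum_mul]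
      rw [intervalIntegral.integral_sub hfint (by
          convert! IntervalIntegrable.sum _ h4 using 2 with u
          simp), intervalIntegral.integral_finsetSum h4, Finset.sum_range_succ', h2, h1]
      simp only [h3, ← Finset.mul_sum]
      ring
    have hbound : |∫ u in (0 : ℝ)..t, (mittagLeffler α (-c * (t - u) ^ α) -
          ∑ k ∈ Finset.range n, (epochCDF μ J k (t - u) - epochCDF μ J (k + 1) (t - u)) *
            (1 - c) ^ k) * waitingDensity α u| ≤
        ∫ u in (0 : ℝ)..t, (1 - c) ^ n * M * waitingDensity α u := by
      rw [← Real.norm_eq_abs]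
      refine intervalIntegral.norm_integral_le_of_norm_le ht.1 (ae_of_all _ fun u hu => ?_)
        ((intervalIntegrable_waitingDensity hα ht.1).const_mul _)
      have hq := waitingDensity_nonneg hα hlaw hu.1
      rw [norm_mul, Real.norm_eq_abs, Real.norm_eq_abs, abs_of_nonneg hq]
      gcongr
      exact ih (t - u) ⟨sub_nonneg.2 hu.2, by linarith [hu.1, ht.2]⟩
    have hle : ∫ u in (0 : ℝ)..t, (1 - c) ^ n * M * waitingDensity α u ≤ (1 - c) ^ n * M := by
      rw [intervalIntegral.integral_const_mul, integral_waitingDensity hα ht.1,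
        ← real_le_eq_one_sub_mittagLeffler (hJ 0) hlaw ht.1]
      exact mul_le_of_le_one_right (by positivity) measureReal_le_one
    rw [hkey, abs_mul, abs_of_nonneg hs, pow_succ', mul_assoc]
    exact mul_le_mul_of_nonneg_left (hbound.trans hle) hs

/-- The epochs tend to infinity in probability. -/
theorem tendsto_epochCDF_zero (hJ : ∀ i, Measurable (J i)) (hindep : iIndepFun J μ)
    (hident : ∀ i, IdentDistrib (J i) (J 0) μ μ) (hpos : ∀ᵐ ω ∂μ, ∀ i, 0 < J i ω) (t : ℝ) :
    Filter.Tendsto (fun n => epochCDF μ J n t) Filter.atTop (nhds 0) := by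
  have hint : ∀ Y : Ω → ℝ, Measurable Y → (∀ᵐ ω ∂μ, 0 ≤ Y ω) →
      Integrable (fun ω => Real.exp (-1 * Y ω)) μ := fun Y hY h0 => by
    refine Integrable.of_bound (C := 1) (by fun_prop) ?_
    filter_upwards [h0] with ω hω
    rw [Real.norm_eq_abs, Real.abs_exp, Real.exp_le_one_iff]
    linarith
  have hJ0 : ∀ᵐ ω ∂μ, 0 ≤ J 0 ω := hpos.mono fun ω h => (h 0).le
  have hT0 : ∀ n, ∀ᵐ ω ∂μ, 0 ≤ epoch J n ω := fun n => hpos.mono fun ω h =>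
    Finset.sum_nonneg fun i _ => (h i).le
  set r := mgf (J 0) μ (-1)
  have hr0 : 0 ≤ r := mgf_nonneg
  have hr1 : r < 1 := by
    have h1 : Integrable (fun ω => 1 - Real.exp (-1 * J 0 ω)) μ :=
      (integrable_const _).sub (hint _ (hJ 0) hJ0)
    have h2 : 0 < ∫ ω, (1 - Real.exp (-1 * J 0 ω)) ∂μ := by
      rw [integral_pos_iff_support_of_nonneg_ae _ h1]
      · have h3 : ∀ᵐ ω ∂μ, ω ∈ Function.support fun ω => 1 - Real.exp (-1 * J 0 ω) := by
          filter_upwards [hpos] with ω hω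
          have : Real.exp (-1 * J 0 ω) < 1 := by
            simpa using hω 0
          exact (sub_pos.2 this).ne'
        have h4 : (Function.support fun ω => 1 - Real.exp (-1 * J 0 ω)) =ᵐ[μ] Set.univ :=
          Filter.eventuallyEq_univ.2 h3
        rw [measure_congr h4, measure_univ]
        exact one_pos
      · filter_upwards [hJ0] with ω hω
        exact sub_nonneg.2 (Real.exp_le_one_iff.2 (by linarith))
    rw [integral_sub (integrable_const _) (hint _ (hJ 0) hJ0)] at h2
    simp only [integral_const, probReal_univ, smul_eq_mul, mul_one] at h2
    exact sub_pos.1 h2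
  have hle : ∀ n, epochCDF μ J n t ≤ Real.exp t * r ^ n := fun n => by
    have h := measure_le_le_exp_mul_mgf (μ := μ) (X := epoch J n) (t := -1) t (by norm_num)
      (hint _ (measurable_epoch hJ n) (hT0 n))
    have he : epoch J n = ∑ i ∈ Finset.range n, J i := by
      funext ω
      simp [epoch]
    have hm : mgf (epoch J n) μ (-1) = r ^ n := by
      rw [he, hindep.mgf_sum hJ]
      simp [mgf_congr_of_identDistrib _ _ (hident _), r]
    rw [hm, neg_neg, one_mul] at h
    exact h
  have hlim := (tendsto_pow_atTop_nhds_zero_of_lt_one hr0 hr1).const_mul (Real.exp t)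
  rw [mul_zero] at hlim
  exact squeeze_zero (fun n => epochCDF_nonneg n t) hle hlim

/-- Almost surely the waiting times are positive and the epochs are unbounded. -/
theorem ae_forall_exists_lt_epoch (hJ : ∀ i, Measurable (J i)) (hindep : iIndepFun J μ)
    (hident : ∀ i, IdentDistrib (J i) (J 0) μ μ) (hpos : ∀ᵐ ω ∂μ, ∀ i, 0 < J i ω) :
    ∀ᵐ ω ∂μ, ∀ t : ℝ, ∃ n, t < epoch J n ω := by
  have h : ∀ m : ℕ, ∀ᵐ ω ∂μ, ∃ n, (m : ℝ) < epoch J n ω := fun m => by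
    have h0 : μ.real {ω | ∀ n, epoch J n ω ≤ m} ≤ 0 :=
      ge_of_tendsto' (tendsto_epochCDF_zero hJ hindep hident hpos m)
        fun n => measureReal_mono fun ω hω => hω n
    have h1 := (measureReal_eq_zero_iff).1 (le_antisymm h0 measureReal_nonneg)
    refine measure_mono_null ?_ h1
    intro ω hω n
    exact not_lt.1 fun hn => hω ⟨n, hn⟩
  filter_upwards [ae_all_iff.2 h] with ω hω t
  obtain ⟨m, hm⟩ := exists_nat_ge t
  obtain ⟨n, hn⟩ := hω m
  exact ⟨n, hm.trans_lt hn⟩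

theorem real_renewalCount_preimage (hJ : ∀ i, Measurable (J i))
    (hpos : ∀ᵐ ω ∂μ, ∀ i, 0 < J i ω) (hub : ∀ᵐ ω ∂μ, ∀ t : ℝ, ∃ n, t < epoch J n ω)
    {t : ℝ} (ht : 0 ≤ t) (k : ℕ) :
    μ.real (renewalCount J t ⁻¹' {k}) = epochCDF μ J k t - epochCDF μ J (k + 1) t := by
  rw [measureReal_congr (renewalCount_preimage_ae_eq hpos hub ht k), eq_sub_iff_add_eq,
    epochCDF, epochCDF, ← measureReal_sdiff_add_inter (s := {ω | epoch J k ω ≤ t})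
      (measurableSet_le (measurable_epoch hJ (k + 1)) measurable_const)]
  congr 1
  refine measureReal_congr ?_
  filter_upwards [hpos] with ω h
  exact propext ⟨fun h1 => ⟨(monotone_epoch h k.le_succ).trans h1, h1⟩, fun h1 => h1.2⟩

/-- The distribution function of the continuous-time maximum as a power series in the distribution
function of the jumps. -/
theorem hasSum_ctMaxCDF (hX : ∀ i, Measurable (X i)) (hJ : ∀ i, Measurable (J i))
    (hXindep : iIndepFun X μ) (hXident : ∀ i, IdentDistrib (X i) (X 0) μ μ)
    (hpos : ∀ᵐ ω ∂μ, ∀ i, 0 < J i ω) (hub : ∀ᵐ ω ∂μ, ∀ t : ℝ, ∃ n, t < epoch J n ω)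
    {t : ℝ} (ht : 0 ≤ t) (hNX : IndepFun (renewalCount J t) (fun ω i => X i ω) μ)
    {e : EReal} {w : ℝ} (he : e ≤ (w : EReal)) :
    HasSum (fun k => (epochCDF μ J k t - epochCDF μ J (k + 1) t) * μ.real {ω | X 0 ω ≤ w} ^ k)
      (ctMaxCDF μ e X J w t) := by
  set S : ℕ → Set (ℕ → ℝ) := fun k => ⋂ i ∈ Finset.range k, (fun x => x i) ⁻¹' Set.Iic w
  have hS : ∀ k, MeasurableSet (S k) := fun k =>
    Finset.measurableSet_biInter _ fun i _ => measurable_pi_apply i measurableSet_Iic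
  have hXS : ∀ k, μ ((fun ω i => X i ω) ⁻¹' S k) = μ {ω | X 0 ω ≤ w} ^ k := fun k => by
    have h := hXindep.measure_inter_preimage_eq_mul (Finset.range k) (sets := fun _ => Set.Iic w)
      fun i _ => measurableSet_Iic
    have h1 : ∀ i, μ (X i ⁻¹' Set.Iic w) = μ {ω | X 0 ω ≤ w} := fun i =>
      (hXident i).measure_mem_eq measurableSet_Iic
    simp only [h1, Finset.prod_const, Finset.card_range] at h
    rw [← h]
    congr 1
    ext ω
    simp [S]
  set A : ℕ → Set Ω := fun k => renewalCount J t ⁻¹' {k} ∩ (fun ω i => X i ω) ⁻¹' S k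
  have hA : ∀ k, NullMeasurableSet (A k) μ := fun k =>
    (nullMeasurableSet_renewalCount_preimage hJ hpos hub ht k).inter
      ((measurable_pi_lambda _ hX) (hS k)).nullMeasurableSet
  have hdisj : Pairwise (Function.onFun (AEDisjoint μ) A) := fun i j hij =>
    Disjoint.aedisjoint <| Set.disjoint_left.2 fun ω hi hj => hij (hi.1.symm.trans hj.1)
  have hunion : {ω | ctMax e X J t ω ≤ (w : EReal)} = ⋃ k, A k := by
    ext ω
    simp only [Set.mem_iUnion, Set.mem_ofPred_eq, ctMax, maxStat_le_iff he]
    constructor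
    · intro h
      exact ⟨renewalCount J t ω, rfl, by simpa [S] using h⟩
    · rintro ⟨k, hk, hkS⟩
      rw [show renewalCount J t ω = k from hk]
      simpa [S] using hkS
  have hmeas : ∀ k, (μ (A k)).toReal =
      (epochCDF μ J k t - epochCDF μ J (k + 1) t) * μ.real {ω | X 0 ω ≤ w} ^ k := fun k => by
    rw [hNX.measure_inter_preimage_eq_mul _ _ (measurableSet_singleton k) (hS k), hXS,
      ENNReal.toReal_mul, ENNReal.toReal_pow, ← real_renewalCount_preimage hJ hpos hub ht]
    rfl
  have hsum := measure_iUnion₀ hdisj hA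
  have hne : ∑' k, μ (A k) ≠ ⊤ := hsum ▸ measure_ne_top _ _
  have h := ENNReal.hasSum_toReal hne
  rw [← ENNReal.tsum_toReal_eq fun k => measure_ne_top _ _, ← hsum, ← hunion] at h
  simpa only [hmeas] using! h

/-- The distribution function of the continuous-time maximum is a Mittag-Leffler function. -/
theorem ctMaxCDF_eq_mittagLeffler (hα : 0 < α) (hX : ∀ i, Measurable (X i))
    (hJ : ∀ i, Measurable (J i)) (hXindep : iIndepFun X μ)
    (hXident : ∀ i, IdentDistrib (X i) (X 0) μ μ) (hJindep : iIndepFun J μ)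
    (hJident : ∀ i, IdentDistrib (J i) (J 0) μ μ)
    (hlaw : ∀ t : ℝ, 0 ≤ t → μ.real {ω | t < J 0 ω} = mittagLeffler α (-(t ^ α)))
    (hpos : ∀ᵐ ω ∂μ, ∀ i, 0 < J i ω)
    {t : ℝ} (ht : 0 ≤ t) (hNX : IndepFun (renewalCount J t) (fun ω i => X i ω) μ)
    {e : EReal} {w : ℝ} (he : e ≤ (w : EReal)) :
    ctMaxCDF μ e X J w t = mittagLeffler α (-(1 - μ.real {ω | X 0 ω ≤ w}) * t ^ α) := by
  have hub := ae_forall_exists_lt_epoch hJ hJindep hJident hpos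
  have h := (hasSum_ctMaxCDF hX hJ hXindep hXident hpos hub ht hNX he).tendsto_sum_nat
  have hF0 : 0 ≤ μ.real {ω | X 0 ω ≤ w} := measureReal_nonneg
  have hF1 : μ.real {ω | X 0 ω ≤ w} ≤ 1 := measureReal_le_one
  generalize μ.real {ω | X 0 ω ≤ w} = F at *
  refine tendsto_nhds_unique h ?_
  rcases hF1.eq_or_lt with rfl | hF1
  · have htel : ∀ n, ∑ k ∈ Finset.range n,
        (epochCDF μ J k t - epochCDF μ J (k + 1) t) * 1 ^ k = 1 - epochCDF μ J n t := fun n => by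
      simp only [one_pow, mul_one]
      rw [Finset.sum_range_sub', epochCDF_zero ht]
    simp only [htel, sub_self, neg_zero, zero_mul, mittagLeffler_zero]
    simpa using (tendsto_epochCDF_zero hJ hJindep hJident hpos t).const_sub 1
  · have hc : |1 - F| ≤ 1 := abs_le.2 ⟨by linarith, by linarith⟩
    obtain ⟨M, hM⟩ := isCompact_Icc.exists_bound_of_continuousOn (s := Set.Icc 0 t)
      (continuous_mittagLeffler_mul_rpow hα hc).continuousOn
    have hbd := fun n => abs_mittagLeffler_sub_sum_le hα (c := 1 - F) (by linarith) (by linarith)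
      hJ hJindep hJident hlaw hpos hM n t ⟨ht, le_rfl⟩
    simp only [sub_sub_cancel] at hbd
    have hlim := (tendsto_pow_atTop_nhds_zero_of_lt_one hF0 hF1).mul_const M
    rw [zero_mul] at hlim
    rw [tendsto_iff_norm_sub_tendsto_zero]
    refine squeeze_zero (fun n => norm_nonneg _) (fun n => ?_) hlim
    rw [norm_sub_rev]
    exact hbd n

end

theorem mainTheorem1 {Ω : Type*} [MeasurableSpace Ω] (μ : Measure Ω) [IsProbabilityMeasure μ]
    (α : ℝ) (hα_pos : 0 < α) (hα_le : α ≤ 1)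
    (X J : ℕ → Ω → ℝ)
    (hX_meas : ∀ i, Measurable (X i)) (hJ_meas : ∀ i, Measurable (J i))
    (hX_indep : iIndepFun X μ) (hX_ident : ∀ i, IdentDistrib (X i) (X 0) μ μ)
    (hJ_indep : iIndepFun J μ) (hJ_ident : ∀ i, IdentDistrib (J i) (J 0) μ μ)
    (hJ_law : ∀ t : ℝ, 0 ≤ t → μ.real {ω | t < J 0 ω} = mittagLeffler α (-(t ^ α)))
    (hNX : ∀ t : ℝ, 0 ≤ t → IndepFun (renewalCount J t) (fun ω i => X i ω) μ) :
    -- almost surely, the maximum that defines `N(t)` exists for all `t`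
    (∀ᵐ ω ∂μ, ∀ t : ℝ, 0 ≤ t → IsGreatest {n : ℕ | epoch J n ω ≤ t} (renewalCount J t ω)) ∧
    ∀ (e : EReal) (w : ℝ), e ≤ (w : EReal) →
      -- the distribution function of the continuous-time maximum
      (∀ t : ℝ, 0 ≤ t →
        ctMaxCDF μ e X J w t = mittagLeffler α (-(1 - μ.real {ω | X 0 ω ≤ w}) * t ^ α)) ∧
      -- it is, as a function of time, the solution of the fractional relaxation equation
      (α < 1 →
        IsFracRelaxation α (1 - μ.real {ω | X 0 ω ≤ w}) (fun t => ctMaxCDF μ e X J w t) ∧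
        ∀ g : ℝ → ℝ, IsFracRelaxation α (1 - μ.real {ω | X 0 ω ≤ w}) g →
          ∀ t : ℝ, 0 ≤ t → g t = ctMaxCDF μ e X J w t) ∧
      -- reduction to the Gumbel law
      (α = 1 → ∀ r : ℝ, 0 < r → μ.map (X 0) = expMeasure r → 0 ≤ w →
        (∀ t : ℝ, 0 ≤ t → ctMaxCDF μ e X J w t = Real.exp (-(Real.exp (-(r * w)) * t))) ∧
        (∀ t : ℝ, 0 < t → ctMaxCDF μ e X J w t = gumbelCDF (Real.log t / r) (1 / r) w)) := by
  have hpos : ∀ᵐ ω ∂μ, ∀ i, 0 < J i ω := ae_all_iff.2 fun i =>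
    (hJ_ident i).symm.ae_snd (p := fun x => 0 < x) measurableSet_Ioi
      (ae_pos_of_law (hJ_meas 0) hα_pos hJ_law)
  have hub := ae_forall_exists_lt_epoch hJ_meas hJ_indep hJ_ident hpos
  refine ⟨?_, fun e w he => ?_⟩
  · filter_upwards [hpos, hub] with ω h1 h2 t ht
    exact isGreatest_renewalCount h1 h2 ht
  have hcdf : ∀ t : ℝ, 0 ≤ t → ctMaxCDF μ e X J w t =
      mittagLeffler α (-(1 - μ.real {ω | X 0 ω ≤ w}) * t ^ α) := fun t ht =>
    ctMaxCDF_eq_mittagLeffler hα_pos hX_meas hJ_meas hX_indep hX_ident hJ_indep hJ_ident hJ_law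
      hpos ht (hNX t ht) he
  refine ⟨hcdf, fun hα1 => ?_, ?_⟩
  · have hF0 : 0 ≤ μ.real {ω | X 0 ω ≤ w} := measureReal_nonneg
    have hF1 : μ.real {ω | X 0 ω ≤ w} ≤ 1 := measureReal_le_one
    have hc : |1 - μ.real {ω | X 0 ω ≤ w}| ≤ 1 := abs_le.2 ⟨by linarith, by linarith⟩
    have hsol := isFracRelaxation_mittagLeffler hα_pos hα1 hc hcdf
    exact ⟨hsol, fun g hg t ht => hg.unique hα_pos hα1 hc hsol ht⟩
  · rintro rfl r hr hlaw hw
    have hexp : ∀ t : ℝ, 0 ≤ t →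
        ctMaxCDF μ e X J w t = Real.exp (-(Real.exp (-(r * w)) * t)) := fun t ht => by
      rw [hcdf t ht, real_le_of_map_eq_expMeasure (hX_meas 0) hr hlaw hw, mittagLeffler_one,
        Real.rpow_one, sub_sub_cancel, neg_mul]
    exact ⟨hexp, fun t ht => by rw [hexp t ht.le, gumbelCDF_log_div hr w ht]⟩
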